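/- **Corollary D.** Let $h=(h_1,h_2,h_3):\mathbb C\to\mathbb R^3$ be the Enneper surface, that is, the minimal map $$h_i(z)=\mathrm{Re}\int_0^z p_i(w)\,dw,\qquad p_1(w)=\tfrac12(1-w^2),\quad p_2(w)=\tfrac i2(1+w^2),\quad p_3(w)=w,$$ and for $r>0$ let $\overline{\mathbb D_r}=\{z\in\mathbb C:|z|\le r\}$. For a smooth map $g$ into $\mathbb R^3$ let $A(\overline{\mathbb D_r},g)=\int_{\overline{\mathbb D_r}}\sqrt{|g_x|^2|g_y|^2-\langle g_x,g_y\rangle^2}\,dx\,dy$ be its area. Then for every $r>1$ the restriction of $h$ to $\overline{\mathbb D_r}$ is unstable: there is a smooth (up to the boundary) vector field $X:\overline{\mathbb D_r}\to\mathbb R^3$, normal to $h$ (that is, $X(z)\perp h_x(z),h_y(z)$ for all $z\in\overline{\mathbb D_r}$) and vanishing on $\partial\mathbb D_r$, such that $t\mapsto A(\overline{\mathbb D_r},h+tX)$ is twice differentiable at $t=0$ with $$\frac{d^2}{dt^2}\Big|_{t=0}A(\overline{\mathbb D_r},h+tX)<0.$$ -/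

import Mathlib

open scoped ContDiff Topology

noncomputable section

namespace MinimalSurface

/-- The map `z ↦ Re ∫_0^z α` into `ℝⁿ` with Weierstrass-Enneper data `α_i = p_i(w) dw`.
The integral is taken along the segment from `0` to `z`, parametrized by `s ↦ s z`,
`s ∈ [0, 1]`. -/
def weierstrassMap {n : ℕ} (p : Fin n → ℂ → ℂ) (z : ℂ) : EuclideanSpace ℝ (Fin n) :=
  WithLp.toLp 2 fun i => (∫ s in (0 : ℝ)..1, p i ((s : ℂ) * z) * z).re

/-- The Weierstrass-Enneper data of the Enneper surface. -/
def enneperData : Fin 3 → ℂ → ℂ :=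
  ![fun z => (1 / 2) * (1 - z ^ 2), fun z => (Complex.I / 2) * (1 + z ^ 2), fun z => z]

/-- The minimal map `ℂ → ℝ³` defining the Enneper surface. -/
def enneper : ℂ → EuclideanSpace ℝ (Fin 3) := weierstrassMap enneperData

/-- The area (counted with multiplicity) of a map `g = g(x + iy)` over `K ⊆ ℂ`:
the integral over `K` of `√(|g_x|² |g_y|² - ⟨g_x, g_y⟩²) dx dy`. -/
def area {n : ℕ} (K : Set ℂ) (g : ℂ → EuclideanSpace ℝ (Fin n)) : ℝ :=
  ∫ z in K, Real.sqrt
    (‖fderiv ℝ g z 1‖ ^ 2 * ‖fderiv ℝ g z Complex.I‖ ^ 2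
      - (inner ℝ (fderiv ℝ g z 1) (fderiv ℝ g z Complex.I)) ^ 2)

/-- `X` is an admissible normal variation field along `h` over the compact region `K`: it is smooth
up to the boundary (the restriction of a smooth map on the plane), it is orthogonal to the surface
`h`, and it vanishes on the boundary of `K`. -/
structure IsNormalVariation {n : ℕ} (K : Set ℂ) (h X : ℂ → EuclideanSpace ℝ (Fin n)) : Prop where
  smooth : ContDiff ℝ ∞ X
  normal : ∀ z ∈ K, ∀ v : ℂ, inner ℝ (X z) (fderiv ℝ h z v) = 0
  boundary : ∀ z ∈ frontier K, X z = 0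

/-- The function `t ↦ A(K, h + t X)` is differentiable near `t = 0` and twice differentiable at
`t = 0`, and its second derivative at `0` is `q`. -/
def HasSecondVariation {n : ℕ} (K : Set ℂ) (h X : ℂ → EuclideanSpace ℝ (Fin n)) (q : ℝ) : Prop :=
  ∃ A' : ℝ → ℝ,
    (∀ᶠ t in 𝓝 (0 : ℝ), HasDerivAt (fun s : ℝ => area K (fun z => h z + s • X z)) (A' t) t) ∧
      HasDerivAt A' q 0

/-- The minimal map `h`, restricted to `K`, is unstable: some normal variation fixing the boundary
has negative second variation of area. -/
def IsUnstable {n : ℕ} (K : Set ℂ) (h : ℂ → EuclideanSpace ℝ (Fin n)) : Prop :=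
  ∃ X : ℂ → EuclideanSpace ℝ (Fin n), IsNormalVariation K h X ∧
    ∃ q : ℝ, HasSecondVariation K h X q ∧ q < 0

end MinimalSurface

end

/-!
The Gauss map `N` of the Enneper surface is inverse stereographic projection, so it maps the disc of
radius `r` onto a spherical cap around the south pole, larger than a hemisphere exactly when
`r > 1`. The coordinate `N₃` is the normal component of a translation, hence a Jacobi function, and
`u = c - N₃` with `c = (r² - 1) / (r² + 1)` is positive inside the disc and vanishes on its
boundary. Therefore the index form of `u` equals `2 c ∫ κ λ u dx dy`, where `κ < 0` is the Gauss
curvature and `λ` the conformal factor. This is negative for `r > 1`, and so is the second variation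
of area along `u N`.

The second variation along `u N` is computed from the conformality of `h`: the second derivative of
the area density at a conformal frame is `|X_x|² + |X_y|²` minus a square involving `⟨h_v, X_w⟩`.
As `h_x - i h_y = p` is holomorphic and orthogonal to `N`, these products are real parts of
multiples of the Hopf coefficient `⟨p', N⟩`, which also determines `|N_w|` in dimension three.
For the Enneper surface this coefficient is constant and the remaining integral is radial.
-/

noncomputable section

namespace MinimalSurface

open Filter MeasureTheory Metric Set
open scoped RealInnerProductSpace

section ParametricIntegral

variable {α : Type*} [TopologicalSpace α] {K : Set α}

theorem isOpen_setOf_forall_pos {T : Type*} [TopologicalSpace T] (hK : IsCompact K)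
    {D : T → α → ℝ} (hD : Continuous ↿D) : IsOpen {t | ∀ z ∈ K, 0 < D t z} :=
  isOpen_iff_mem_nhds.2 fun _ ht => hK.eventually_forall_of_forall_eventually fun z hz =>
    hD.continuousAt.eventually (lt_mem_nhds (ht z hz))

variable [T2Space α] [MeasurableSpace α] [OpensMeasurableSpace α] {μ : Measure α}
  [IsFiniteMeasureOnCompacts μ]

theorem hasDerivAt_setIntegral_of_continuousOn {𝕜 E : Type*} [RCLike 𝕜] [NormedAddCommGroup E]
    [NormedSpace ℝ E] [NormedSpace 𝕜 E] (hK : IsCompact K) {U : Set 𝕜} (hU : IsOpen U)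
    {F F' : 𝕜 → α → E} (hF : ∀ t ∈ U, ContinuousOn (F t) K) (hF' : ContinuousOn ↿F' (U ×ˢ K))
    (hderiv : ∀ t ∈ U, ∀ z ∈ K, HasDerivAt (F · z) (F' t z) t) {t : 𝕜} (ht : t ∈ U) :
    HasDerivAt (fun s => ∫ z in K, F s z ∂μ) (∫ z in K, F' t z ∂μ) t := by
  obtain ⟨V, hVt, hVU, hV⟩ := local_compact_nhds (hU.mem_nhds ht)
  obtain ⟨C, hC⟩ := (hV.prod hK).exists_bound_of_continuousOn
    (hF'.mono (prod_mono hVU subset_rfl))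
  have hint : ∀ s ∈ U, IntegrableOn (F s) K μ := fun s hs => (hF s hs).integrableOn_compact hK
  have hint' : IntegrableOn (F' t) K μ :=
    (hF'.uncurry_left t ht).integrableOn_compact hK
  have hae {p : α → Prop} (hp : ∀ z ∈ K, p z) : ∀ᵐ z ∂μ.restrict K, p z :=
    ae_restrict_of_forall_mem hK.measurableSet hp
  exact (hasDerivAt_integral_of_dominated_loc_of_deriv_le hVt
    (eventually_of_mem hVt fun s hs => (hint s (hVU hs)).aestronglyMeasurable) (hint t ht)
    hint'.aestronglyMeasurable (hae fun z hz s hs => hC (s, z) ⟨hs, hz⟩)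
    (integrableOn_const hK.measure_lt_top.ne)
    (hae fun z hz s hs => hderiv s (hVU hs) z hz)).2

theorem hasDerivAt_deriv_sqrt {D D' : ℝ → ℝ} {D'' t : ℝ} (hD : HasDerivAt D (D' t) t)
    (hD' : HasDerivAt D' D'' t) (ht : 0 < D t) :
    HasDerivAt (fun s => D' s / (2 * √(D s)))
      (D'' / (2 * √(D t)) - D' t ^ 2 / (4 * √(D t) ^ 3)) t := by
  have hne : √(D t) ≠ 0 := (Real.sqrt_pos.2 ht).ne'
  refine (hD'.div ((hD.sqrt ht.ne').const_mul 2) (mul_ne_zero two_ne_zero hne)).congr_deriv ?_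
  field_simp
  ring

theorem hasDerivAt_setIntegral_sqrt (hK : IsCompact K) {D D' D'' : ℝ → α → ℝ}
    (hD : ∀ t z, HasDerivAt (D · z) (D' t z) t) (hD' : ∀ t z, HasDerivAt (D' · z) (D'' t z) t)
    (hDc : Continuous ↿D) (hDc' : Continuous ↿D') (hDc'' : Continuous ↿D'')
    (hpos : ∀ z ∈ K, 0 < D 0 z) :
    (∀ᶠ t in 𝓝 0, HasDerivAt (fun s => ∫ z in K, √(D s z) ∂μ)
        (∫ z in K, D' t z / (2 * √(D t z)) ∂μ) t) ∧
      HasDerivAt (fun t => ∫ z in K, D' t z / (2 * √(D t z)) ∂μ)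
        (∫ z in K, (D'' 0 z / (2 * √(D 0 z)) - D' 0 z ^ 2 / (4 * √(D 0 z) ^ 3)) ∂μ) 0 := by
  set U := {t | ∀ z ∈ K, 0 < D t z}
  have hU : IsOpen U := isOpen_setOf_forall_pos hK hDc
  have hS : Continuous fun p : ℝ × α => √(D p.1 p.2) := hDc.sqrt
  have hne : ∀ p ∈ U ×ˢ K, √(D p.1 p.2) ≠ 0 := fun p hp =>
    (Real.sqrt_pos.2 (hp.1 p.2 hp.2)).ne'
  have hcont' : ContinuousOn (fun p : ℝ × α => D' p.1 p.2 / (2 * √(D p.1 p.2))) (U ×ˢ K) :=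
    hDc'.continuousOn.div (by fun_prop) fun p hp => mul_ne_zero two_ne_zero (hne p hp)
  have hcont'' : ContinuousOn (fun p : ℝ × α => D'' p.1 p.2 / (2 * √(D p.1 p.2)) -
      D' p.1 p.2 ^ 2 / (4 * √(D p.1 p.2) ^ 3)) (U ×ˢ K) :=
    (hDc''.continuousOn.div (by fun_prop) fun p hp => mul_ne_zero two_ne_zero (hne p hp)).sub
      ((hDc'.pow 2).continuousOn.div (by fun_prop) fun p hp =>
        mul_ne_zero four_ne_zero (pow_ne_zero 3 (hne p hp)))
  constructor
  · filter_upwards [hU.mem_nhds hpos] with t ht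
    exact hasDerivAt_setIntegral_of_continuousOn hK hU
      (fun s _ => (hS.comp (by fun_prop : Continuous fun z => (s, z))).continuousOn) hcont'
      (fun s hs z hz => (hD s z).sqrt (hs z hz).ne') ht
  · exact hasDerivAt_setIntegral_of_continuousOn hK hU
      (F := fun s z => D' s z / (2 * √(D s z)))
      (fun s hs => hcont'.comp (by fun_prop : Continuous fun z => (s, z)).continuousOn
        fun z hz => ⟨hs, hz⟩) hcont''
      (fun s hs z hz => hasDerivAt_deriv_sqrt (hD s z) (hD' s z) (hs z hz)) hpos

end ParametricIntegral

section InnerProduct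

variable {E : Type*} [NormedAddCommGroup E] [InnerProductSpace ℝ E]

/-- The Gram determinant of two vectors, the square of the area element in `area`. -/
def gramDet (a b : E) : ℝ := ‖a‖ ^ 2 * ‖b‖ ^ 2 - ⟪a, b⟫ ^ 2

/-- The derivative of `gramDet` at `(a, b)` in the direction `(u, v)`. -/
def gramDetDeriv (a b u v : E) : ℝ :=
  2 * (⟪a, u⟫ * ‖b‖ ^ 2 + ‖a‖ ^ 2 * ⟪b, v⟫ - ⟪a, b⟫ * (⟪a, v⟫ + ⟪u, b⟫))

/-- The second derivative of `gramDet` at `(a, b)` in the direction `(u, v)`. -/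
def gramDetDeriv₂ (a b u v : E) : ℝ :=
  2 * (‖u‖ ^ 2 * ‖b‖ ^ 2 + 4 * ⟪a, u⟫ * ⟪b, v⟫ + ‖a‖ ^ 2 * ‖v‖ ^ 2
    - (⟪a, v⟫ + ⟪u, b⟫) ^ 2 - 2 * ⟪a, b⟫ * ⟪u, v⟫)

theorem hasDerivAt_gramDet_line (a b u v : E) (t : ℝ) :
    HasDerivAt (fun s : ℝ => gramDet (a + s • u) (b + s • v))
      (gramDetDeriv (a + t • u) (b + t • v) u v) t := by
  have ha : HasDerivAt (fun s : ℝ => a + s • u) u t := by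
    simpa using ((hasDerivAt_id t).smul_const u).const_add a
  have hb : HasDerivAt (fun s : ℝ => b + s • v) v t := by
    simpa using ((hasDerivAt_id t).smul_const v).const_add b
  refine ((ha.norm_sq.mul hb.norm_sq).sub ((ha.inner ℝ hb).pow 2)).congr_deriv ?_
  simp only [gramDetDeriv]
  ring

theorem hasDerivAt_gramDetDeriv_line (a b u v : E) (t : ℝ) :
    HasDerivAt (fun s : ℝ => gramDetDeriv (a + s • u) (b + s • v) u v)
      (gramDetDeriv₂ (a + t • u) (b + t • v) u v) t := by
  have ha : HasDerivAt (fun s : ℝ => a + s • u) u t := by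
    simpa using ((hasDerivAt_id t).smul_const u).const_add a
  have hb : HasDerivAt (fun s : ℝ => b + s • v) v t := by
    simpa using ((hasDerivAt_id t).smul_const v).const_add b
  have hu := hasDerivAt_const t u
  have hv := hasDerivAt_const t v
  refine (((((ha.inner ℝ hu).mul hb.norm_sq).add (ha.norm_sq.mul (hb.inner ℝ hv))).sub
    ((ha.inner ℝ hb).mul ((ha.inner ℝ hv).add (hu.inner ℝ hb)))).const_mul 2).congr_deriv ?_
  simp only [gramDetDeriv₂, inner_zero_left, inner_zero_right, real_inner_self_eq_norm_sq,
    Pi.add_apply]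
  ring

theorem gramDet_of_inner_eq_zero {a b : E} (hab : ⟪a, b⟫ = 0) (hnorm : ‖b‖ = ‖a‖) :
    gramDet a b = (‖a‖ ^ 2) ^ 2 := by
  rw [gramDet, hab, hnorm]
  ring

theorem second_deriv_sqrt_gramDet_of_inner_eq_zero {a b : E} (ha : a ≠ 0) (hab : ⟪a, b⟫ = 0)
    (hnorm : ‖b‖ = ‖a‖) (u v : E) :
    gramDetDeriv₂ a b u v / (2 * √(gramDet a b)) -
        gramDetDeriv a b u v ^ 2 / (4 * √(gramDet a b) ^ 3) =
      ‖u‖ ^ 2 + ‖v‖ ^ 2 -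
        ((⟪a, u⟫ - ⟪b, v⟫) ^ 2 + (⟪a, v⟫ + ⟪b, u⟫) ^ 2) / ‖a‖ ^ 2 := by
  have hne : ‖a‖ ≠ 0 := norm_ne_zero_iff.2 ha
  rw [gramDet_of_inner_eq_zero hab hnorm, Real.sqrt_sq (by positivity), gramDetDeriv,
    gramDetDeriv₂, hab, hnorm, real_inner_comm b u]
  field_simp
  ring

theorem norm_sq_mul_norm_sq_eq_of_orthogonal (hE : Module.finrank ℝ E = 3)
    {a b ν x : E} (ha : a ≠ 0) (hnorm : ‖b‖ = ‖a‖) (hν : ‖ν‖ = 1) (hab : ⟪a, b⟫ = 0)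
    (haν : ⟪a, ν⟫ = 0) (hbν : ⟪b, ν⟫ = 0) (hx : ⟪ν, x⟫ = 0) :
    ‖a‖ ^ 2 * ‖x‖ ^ 2 = ⟪a, x⟫ ^ 2 + ⟪b, x⟫ ^ 2 := by
  have hne : ‖a‖ ≠ 0 := norm_ne_zero_iff.2 ha
  have hon : Orthonormal ℝ ![‖a‖⁻¹ • a, ‖a‖⁻¹ • b, ν] := by
    simp [orthonormal_vecCons_iff, Fin.forall_fin_succ, norm_smul, real_inner_smul_left,
      inner_smul_right, hnorm, hν, hab, haν, hbν, hne]
  have hspan : ⊤ ≤ Submodule.span ℝ (range ![‖a‖⁻¹ • a, ‖a‖⁻¹ • b, ν]) :=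
    (hon.linearIndependent.span_eq_top_of_card_eq_finrank (by simp [hE])).ge
  have hparseval := (OrthonormalBasis.mk hon hspan).sum_sq_norm_inner_right x
  rw [← hparseval]
  simp only [OrthonormalBasis.coe_mk, Fin.sum_univ_three, Matrix.cons_val, real_inner_smul_left,
    hx, Real.norm_eq_abs, sq_abs]
  field_simp
  ring

end InnerProduct

section ConformalAt

variable {E F : Type*} [NormedAddCommGroup E] [InnerProductSpace ℝ E] [NormedAddCommGroup F]
  [InnerProductSpace ℝ F] {f : E → F} {x u v : E}

theorem fderiv_ne_zero_of_conformalAt (hf : ConformalAt f x) (hu : u ≠ 0) : fderiv ℝ f x u ≠ 0 :=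
  (map_ne_zero_iff _ (conformalAt_iff_isConformalMap_fderiv.1 hf).injective).2 hu

theorem inner_fderiv_eq_zero_of_conformalAt (hf : ConformalAt f x) (huv : ⟪u, v⟫ = 0) :
    ⟪fderiv ℝ f x u, fderiv ℝ f x v⟫ = 0 := by
  rw [conformalFactorAt_inner_eq_mul_inner' hf, huv, mul_zero]

theorem norm_fderiv_eq_of_conformalAt (hf : ConformalAt f x) (huv : ‖u‖ = ‖v‖) :
    ‖fderiv ℝ f x u‖ = ‖fderiv ℝ f x v‖ := by
  rw [← sq_eq_sq₀ (norm_nonneg _) (norm_nonneg _), ← real_inner_self_eq_norm_sq,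
    ← real_inner_self_eq_norm_sq, conformalFactorAt_inner_eq_mul_inner' hf,
    conformalFactorAt_inner_eq_mul_inner' hf, real_inner_self_eq_norm_sq,
    real_inner_self_eq_norm_sq, huv]

end ConformalAt

section Differential

variable {E F : Type*} [NormedAddCommGroup E] [NormedSpace ℝ E] [NormedAddCommGroup F]
  [NormedSpace ℝ F]

theorem fderiv_add_smul_apply {f g : E → F} {x : E} (hf : DifferentiableAt ℝ f x)
    (hg : DifferentiableAt ℝ g x) (t : ℝ) (v : E) :
    fderiv ℝ (fun y => f y + t • g y) x v = fderiv ℝ f x v + t • fderiv ℝ g x v := by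
  simp [fderiv_fun_add hf (hg.fun_const_smul t), fderiv_fun_const_smul hg]

theorem norm_gradient_sq (u : ℂ → ℝ) (z : ℂ) :
    ‖gradient u z‖ ^ 2 = fderiv ℝ u z 1 ^ 2 + fderiv ℝ u z Complex.I ^ 2 := by
  rw [← inner_gradient_left, ← inner_gradient_left, Complex.sq_norm, Complex.normSq_apply]
  simp only [Complex.inner, Complex.mul_re, Complex.conj_re, Complex.conj_im, Complex.one_re,
    Complex.one_im, Complex.I_re, Complex.I_im]
  ring

end Differential

section SecondVariation

variable {n : ℕ} {K : Set ℂ} {h X : ℂ → EuclideanSpace ℝ (Fin n)}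

theorem area_add_smul (hh : Differentiable ℝ h) (hX : Differentiable ℝ X) (t : ℝ) :
    area K (fun z => h z + t • X z) =
      ∫ z in K, √(gramDet (fderiv ℝ h z 1 + t • fderiv ℝ X z 1)
        (fderiv ℝ h z Complex.I + t • fderiv ℝ X z Complex.I)) := by
  simp only [area, gramDet, fderiv_add_smul_apply (hh _) (hX _)]

theorem hasSecondVariation_of_conformalAt (hK : IsCompact K) (hh : ContDiff ℝ 1 h)
    (hX : ContDiff ℝ 1 X) (hconf : ∀ z ∈ K, ConformalAt h z) :
    HasSecondVariation K h X (∫ z in K, (‖fderiv ℝ X z 1‖ ^ 2 + ‖fderiv ℝ X z Complex.I‖ ^ 2 -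
      ((⟪fderiv ℝ h z 1, fderiv ℝ X z 1⟫ - ⟪fderiv ℝ h z Complex.I, fderiv ℝ X z Complex.I⟫) ^ 2 +
        (⟪fderiv ℝ h z 1, fderiv ℝ X z Complex.I⟫ + ⟪fderiv ℝ h z Complex.I, fderiv ℝ X z 1⟫) ^ 2) /
        ‖fderiv ℝ h z 1‖ ^ 2)) := by
  have hne : ∀ z ∈ K, fderiv ℝ h z 1 ≠ 0 := fun z hz =>
    fderiv_ne_zero_of_conformalAt (hconf z hz) one_ne_zero
  have hortho : ∀ z ∈ K, ⟪fderiv ℝ h z 1, fderiv ℝ h z Complex.I⟫ = 0 := fun z hz =>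
    inner_fderiv_eq_zero_of_conformalAt (hconf z hz) (by simp)
  have hnorm : ∀ z ∈ K, ‖fderiv ℝ h z Complex.I‖ = ‖fderiv ℝ h z 1‖ := fun z hz =>
    norm_fderiv_eq_of_conformalAt (hconf z hz) (by simp)
  obtain ⟨hfirst, hsecond⟩ := hasDerivAt_setIntegral_sqrt (μ := volume) hK
    (fun t z => hasDerivAt_gramDet_line (fderiv ℝ h z 1) (fderiv ℝ h z Complex.I)
      (fderiv ℝ X z 1) (fderiv ℝ X z Complex.I) t)
    (fun t z => hasDerivAt_gramDetDeriv_line _ _ _ _ t)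
    (by unfold gramDet; fun_prop) (by unfold gramDetDeriv; fun_prop)
    (by unfold gramDetDeriv₂; fun_prop) fun z hz => by
      have := norm_pos_iff.2 (hne z hz)
      simp only [zero_smul, add_zero, gramDet_of_inner_eq_zero (hortho z hz) (hnorm z hz)]
      positivity
  refine ⟨_, ?_, hsecond.congr_deriv (setIntegral_congr_fun hK.measurableSet fun z hz => ?_)⟩
  · simpa only [area_add_smul (hh.differentiable one_ne_zero) (hX.differentiable one_ne_zero)]
      using hfirst
  · simpa only [zero_smul, add_zero] using
      second_deriv_sqrt_gramDet_of_inner_eq_zero (hne z hz) (hortho z hz) (hnorm z hz) _ _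

end SecondVariation

section Weierstrass

variable {n : ℕ} {p : Fin n → ℂ → ℂ}

theorem hasDerivAt_integral_segment {f : ℂ → ℂ} (hf : Differentiable ℂ f) (z : ℂ) :
    HasDerivAt (fun z => ∫ s in (0 : ℝ)..1, f (s * z) * z) (f z) z := by
  obtain ⟨g, hg0, hg⟩ := hf.isExactOn_univ.with_val_at 0 0
  suffices hgf : ∀ w, ∫ s in (0 : ℝ)..1, f (s * w) * w = g w by
    simpa only [hgf] using hg z (mem_univ z)
  intro w
  have hderiv (s : ℝ) : HasDerivAt (fun s : ℝ => g (s * w)) (f (s * w) * w) s := by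
    have hline : HasDerivAt (fun s : ℝ => (s : ℂ) * w) w s := by
      simpa using (Complex.ofRealCLM.hasDerivAt (x := s)).mul_const w
    exact (hg _ (mem_univ _)).comp s hline
  have hcont : Continuous fun s : ℝ => f (s * w) * w := by
    have := hf.continuous
    fun_prop
  rw [intervalIntegral.integral_eq_sub_of_hasDerivAt (fun s _ => hderiv s)
    (hcont.intervalIntegrable _ _)]
  simp [hg0]

theorem contDiff_weierstrassMap (hp : ∀ i, Differentiable ℂ (p i)) {m : WithTop ℕ∞} :
    ContDiff ℝ m (weierstrassMap p) := by
  refine contDiff_euclidean.2 fun i => ?_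
  have hdiff : Differentiable ℂ fun z => ∫ s in (0 : ℝ)..1, p i (s * z) * z := fun z =>
    (hasDerivAt_integral_segment (hp i) z).differentiableAt
  exact Complex.reCLM.contDiff.comp (hdiff.contDiff.restrict_scalars ℝ)

theorem fderiv_weierstrassMap_apply (hp : ∀ i, Differentiable ℂ (p i)) (z v : ℂ) (i : Fin n) :
    fderiv ℝ (weierstrassMap p) z v i = (v * p i z).re := by
  have hcoord : HasFDerivAt (fun z => weierstrassMap p z i) _ z :=
    Complex.reCLM.hasFDerivAt.comp z
      ((hasDerivAt_integral_segment (hp i) z).hasFDerivAt.restrictScalars ℝ)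
  have hmap := ((contDiff_weierstrassMap hp (m := 1)).differentiable one_ne_zero z).hasFDerivAt
  have hproj := ((EuclideanSpace.proj (𝕜 := ℝ) i).hasFDerivAt).comp z hmap
  simpa using DFunLike.congr_fun (hproj.unique hcoord) v

theorem inner_fderiv_weierstrassMap (hp : ∀ i, Differentiable ℂ (p i)) (z v : ℂ)
    (y : EuclideanSpace ℝ (Fin n)) :
    ⟪fderiv ℝ (weierstrassMap p) z v, y⟫ = (v * ∑ i, p i z * y i).re := by
  simp only [PiLp.inner_apply, fderiv_weierstrassMap_apply hp, Finset.mul_sum, Complex.re_sum,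
    ← mul_assoc, Complex.re_mul_ofReal, RCLike.inner_apply, conj_trivial, mul_comm]

/-- Weierstrass data of a minimal immersion of the plane: `p` is entire, and the null vector
`(p_i(z))` is nowhere zero. -/
structure IsMinimalData (p : Fin n → ℂ → ℂ) : Prop where
  differentiable : ∀ i, Differentiable ℂ (p i)
  sum_sq_eq_zero : ∀ z, ∑ i, p i z ^ 2 = 0
  exists_ne_zero : ∀ z, ∃ i, p i z ≠ 0

/-- The conformal factor `|h_x|² = |h_y|²` of the minimal surface `h` with data `p`. -/
def conformalFactor (p : Fin n → ℂ → ℂ) (z : ℂ) : ℝ := (∑ i, ‖p i z‖ ^ 2) / 2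

theorem IsMinimalData.conformalFactor_pos (hp : IsMinimalData p) (z : ℂ) :
    0 < conformalFactor p z := by
  obtain ⟨i, hi⟩ := hp.exists_ne_zero z
  have := norm_pos_iff.2 hi
  exact half_pos (Finset.sum_pos' (fun _ _ => by positivity) ⟨i, Finset.mem_univ i, by positivity⟩)

theorem IsMinimalData.inner_fderiv_fderiv (hp : IsMinimalData p) (z v w : ℂ) :
    ⟪fderiv ℝ (weierstrassMap p) z v, fderiv ℝ (weierstrassMap p) z w⟫ =
      conformalFactor p z * ⟪v, w⟫ := by
  have hre (a : ℂ) : (v * a).re * (w * a).re = (v * w * a ^ 2).re / 2 + ‖a‖ ^ 2 / 2 * ⟪v, w⟫ := by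
    rw [Complex.sq_norm, Complex.normSq_apply, Complex.inner]
    simp only [pow_two, Complex.mul_re, Complex.mul_im, Complex.conj_re, Complex.conj_im]
    ring
  calc ⟪fderiv ℝ (weierstrassMap p) z v, fderiv ℝ (weierstrassMap p) z w⟫
      = ∑ i, (v * p i z).re * (w * p i z).re := by
        simp only [PiLp.inner_apply, fderiv_weierstrassMap_apply hp.differentiable,
          RCLike.inner_apply, conj_trivial, mul_comm]
    _ = (v * w * ∑ i, p i z ^ 2).re / 2 + conformalFactor p z * ⟪v, w⟫ := by
        simp only [hre, Finset.sum_add_distrib, Finset.mul_sum, Complex.re_sum, Finset.sum_div,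
          conformalFactor, Finset.sum_mul]
    _ = conformalFactor p z * ⟪v, w⟫ := by simp [hp.sum_sq_eq_zero]

theorem IsMinimalData.norm_sq_fderiv (hp : IsMinimalData p) (z v : ℂ) :
    ‖fderiv ℝ (weierstrassMap p) z v‖ ^ 2 = conformalFactor p z * ‖v‖ ^ 2 := by
  rw [← real_inner_self_eq_norm_sq, hp.inner_fderiv_fderiv, real_inner_self_eq_norm_sq]

theorem IsMinimalData.conformalAt (hp : IsMinimalData p) (z : ℂ) :
    ConformalAt (weierstrassMap p) z :=
  conformalAt_iff'.2 ⟨_, hp.conformalFactor_pos z, hp.inner_fderiv_fderiv z⟩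

/-- A smooth unit normal field `N` of the minimal surface with data `p`. As `h_x - i h_y = p`,
orthogonality to the surface is one complex equation. -/
structure IsUnitNormal (p : Fin n → ℂ → ℂ) (N : ℂ → EuclideanSpace ℝ (Fin n)) : Prop where
  contDiff : ContDiff ℝ ∞ N
  norm_eq_one : ∀ z, ‖N z‖ = 1
  sum_mul_eq_zero : ∀ z, ∑ i, p i z * N z i = 0

/-- The coefficient `⟨p', N⟩ = 2 ⟨h_zz, N⟩` of the Hopf differential of the minimal surface `h` with
data `p` and unit normal `N`. -/
def hopfCoeff (p : Fin n → ℂ → ℂ) (N : ℂ → EuclideanSpace ℝ (Fin n)) (z : ℂ) : ℂ :=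
  ∑ i, deriv (p i) z * N z i

variable {N : ℂ → EuclideanSpace ℝ (Fin n)}

theorem IsUnitNormal.inner_fderiv_weierstrassMap_eq_zero (hN : IsUnitNormal p N)
    (hp : ∀ i, Differentiable ℂ (p i)) (z v : ℂ) :
    ⟪fderiv ℝ (weierstrassMap p) z v, N z⟫ = 0 := by
  rw [inner_fderiv_weierstrassMap hp, hN.sum_mul_eq_zero, mul_zero, Complex.zero_re]

theorem IsUnitNormal.isNormalVariation_smul (hN : IsUnitNormal p N)
    (hp : ∀ i, Differentiable ℂ (p i)) {K : Set ℂ} {u : ℂ → ℝ} (hu : ContDiff ℝ ∞ u)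
    (hu0 : ∀ z ∈ frontier K, u z = 0) :
    IsNormalVariation K (weierstrassMap p) fun z => u z • N z where
  smooth := hu.smul hN.contDiff
  normal z _ v := by
    rw [real_inner_smul_left, real_inner_comm, hN.inner_fderiv_weierstrassMap_eq_zero hp, mul_zero]
  boundary z hz := by rw [hu0 z hz, zero_smul]

theorem IsUnitNormal.differentiable (hN : IsUnitNormal p N) : Differentiable ℝ N :=
  hN.contDiff.differentiable (by simp)

theorem IsUnitNormal.inner_fderiv_self (hN : IsUnitNormal p N) (z w : ℂ) :
    ⟪N z, fderiv ℝ N z w⟫ = 0 := by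
  have hconst : HasFDerivAt (fun z => ‖N z‖ ^ 2) _ z := (hN.differentiable z).hasFDerivAt.norm_sq
  simp only [hN.norm_eq_one] at hconst
  simpa using DFunLike.congr_fun (hconst.unique (hasFDerivAt_const _ _)) w

theorem IsUnitNormal.sum_mul_fderiv (hN : IsUnitNormal p N) (hp : ∀ i, Differentiable ℂ (p i))
    (z w : ℂ) : ∑ i, p i z * fderiv ℝ N z w i = -(w * hopfCoeff p N z) := by
  have hNi (i : Fin n) : HasFDerivAt (fun z => (N z i : ℂ)) _ z :=
    Complex.ofRealCLM.hasFDerivAt.comp z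
      ((EuclideanSpace.proj (𝕜 := ℝ) i).hasFDerivAt.comp z (hN.differentiable z).hasFDerivAt)
  have hpi (i : Fin n) := (hp i z).hasDerivAt.hasFDerivAt.restrictScalars ℝ
  have hsum := HasFDerivAt.fun_sum (u := Finset.univ) fun i _ => (hpi i).mul (hNi i)
  simp only [Pi.mul_apply, hN.sum_mul_eq_zero] at hsum
  have hzero := DFunLike.congr_fun (hsum.unique (hasFDerivAt_const (0 : ℂ) z)) w
  rw [hopfCoeff, eq_neg_iff_add_eq_zero, Finset.mul_sum, ← Finset.sum_add_distrib]
  simpa [mul_comm, mul_left_comm, mul_assoc] using hzero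

theorem IsUnitNormal.inner_fderiv_weierstrassMap_fderiv (hN : IsUnitNormal p N)
    (hp : ∀ i, Differentiable ℂ (p i)) (z v w : ℂ) :
    ⟪fderiv ℝ (weierstrassMap p) z v, fderiv ℝ N z w⟫ = -(v * w * hopfCoeff p N z).re := by
  rw [inner_fderiv_weierstrassMap hp, hN.sum_mul_fderiv hp, mul_neg, Complex.neg_re, mul_assoc]

theorem IsMinimalData.conformalFactor_mul_norm_sq_fderiv {p : Fin 3 → ℂ → ℂ}
    {N : ℂ → EuclideanSpace ℝ (Fin 3)} (hp : IsMinimalData p) (hN : IsUnitNormal p N) (z w : ℂ) :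
    conformalFactor p z * ‖fderiv ℝ N z w‖ ^ 2 = ‖hopfCoeff p N z‖ ^ 2 * ‖w‖ ^ 2 := by
  have hconf := hp.conformalAt z
  have hframe := norm_sq_mul_norm_sq_eq_of_orthogonal (by simp)
    (fderiv_ne_zero_of_conformalAt hconf one_ne_zero)
    (norm_fderiv_eq_of_conformalAt (u := Complex.I) hconf (by simp)) (hN.norm_eq_one z)
    (inner_fderiv_eq_zero_of_conformalAt hconf (by simp))
    (hN.inner_fderiv_weierstrassMap_eq_zero hp.differentiable z _)
    (hN.inner_fderiv_weierstrassMap_eq_zero hp.differentiable z _) (hN.inner_fderiv_self z w)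
  rw [hp.norm_sq_fderiv, norm_one, one_pow, mul_one,
    hN.inner_fderiv_weierstrassMap_fderiv hp.differentiable,
    hN.inner_fderiv_weierstrassMap_fderiv hp.differentiable] at hframe
  rw [hframe, ← mul_pow, mul_comm ‖_‖, ← norm_mul, one_mul, mul_assoc, Complex.I_mul_re, neg_neg,
    neg_sq, Complex.sq_norm, Complex.normSq_apply]
  ring

theorem IsUnitNormal.norm_sq_fderiv_smul (hN : IsUnitNormal p N) {u : ℂ → ℝ} {z : ℂ}
    (hu : DifferentiableAt ℝ u z) (w : ℂ) :
    ‖fderiv ℝ (fun z => u z • N z) z w‖ ^ 2 =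
      fderiv ℝ u z w ^ 2 + u z ^ 2 * ‖fderiv ℝ N z w‖ ^ 2 := by
  rw [fderiv_fun_smul hu (hN.differentiable z), add_apply, smul_apply,
    ContinuousLinearMap.smulRight_apply, norm_add_sq_real, inner_smul_left, inner_smul_right,
    real_inner_comm, hN.inner_fderiv_self, norm_smul, norm_smul, hN.norm_eq_one]
  simp only [mul_pow, Real.norm_eq_abs, sq_abs]
  ring

theorem IsUnitNormal.inner_fderiv_weierstrassMap_fderiv_smul (hN : IsUnitNormal p N)
    (hp : ∀ i, Differentiable ℂ (p i)) {u : ℂ → ℝ} {z : ℂ} (hu : DifferentiableAt ℝ u z)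
    (v w : ℂ) :
    ⟪fderiv ℝ (weierstrassMap p) z v, fderiv ℝ (fun z => u z • N z) z w⟫ =
      -(u z * (v * w * hopfCoeff p N z).re) := by
  rw [fderiv_fun_smul hu (hN.differentiable z), add_apply, smul_apply,
    ContinuousLinearMap.smulRight_apply, inner_add_right, inner_smul_right, inner_smul_right,
    hN.inner_fderiv_weierstrassMap_fderiv hp, hN.inner_fderiv_weierstrassMap_eq_zero hp]
  ring

/-- The index form `∫_K (|∇u|² + 2 κ λ u²) dx dy` of the minimal surface with data `p` and unit
normal `N`, where `λ` is the conformal factor and `κ = -|⟨p', N⟩|² / λ²` the Gauss curvature. -/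
def indexForm (p : Fin n → ℂ → ℂ) (N : ℂ → EuclideanSpace ℝ (Fin n)) (K : Set ℂ) (u : ℂ → ℝ) : ℝ :=
  ∫ z in K, (‖gradient u z‖ ^ 2 - 2 * ‖hopfCoeff p N z‖ ^ 2 / conformalFactor p z * u z ^ 2)

theorem hasSecondVariation_weierstrassMap_smul {p : Fin 3 → ℂ → ℂ}
    {N : ℂ → EuclideanSpace ℝ (Fin 3)} (hp : IsMinimalData p) (hN : IsUnitNormal p N)
    {K : Set ℂ} (hK : IsCompact K) {u : ℂ → ℝ} (hu : ContDiff ℝ 1 u) :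
    HasSecondVariation K (weierstrassMap p) (fun z => u z • N z) (indexForm p N K u) := by
  have hX : ContDiff ℝ 1 fun z => u z • N z := hu.smul (hN.contDiff.of_le (by simp))
  rw [indexForm]
  convert hasSecondVariation_of_conformalAt hK (contDiff_weierstrassMap hp.differentiable) hX
    (fun z _ => hp.conformalAt z) using 3 with z
  have hud := hu.differentiable one_ne_zero z
  have hlam := (hp.conformalFactor_pos z).ne'
  have hfderiv (w : ℂ) (hw : ‖w‖ = 1) :
      ‖fderiv ℝ N z w‖ ^ 2 = ‖hopfCoeff p N z‖ ^ 2 / conformalFactor p z := by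
    rw [eq_div_iff hlam, mul_comm, hp.conformalFactor_mul_norm_sq_fderiv hN, hw, one_pow, mul_one]
  simp only [hN.norm_sq_fderiv_smul hud, hp.norm_sq_fderiv, hfderiv 1 norm_one,
    hfderiv _ Complex.norm_I, norm_gradient_sq,
    hN.inner_fderiv_weierstrassMap_fderiv_smul hp.differentiable hud]
  simp only [one_mul, mul_one, Complex.I_mul_I, neg_mul, Complex.neg_re, Complex.I_mul_re,
    Complex.sq_norm, Complex.normSq_apply, norm_one]
  field_simp
  ring

end Weierstrass

section Radial

theorem setIntegral_closedBall_fun_norm {E F : Type*} [NormedAddCommGroup E] [NormedSpace ℝ E]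
    [FiniteDimensional ℝ E] [Nontrivial E] [MeasurableSpace E] [BorelSpace E]
    [NormedAddCommGroup F] [NormedSpace ℝ F] (μ : Measure E) [μ.IsAddHaarMeasure] {r : ℝ}
    (hr : 0 ≤ r) (f : ℝ → F) :
    ∫ x in closedBall 0 r, f ‖x‖ ∂μ = Module.finrank ℝ E • μ.real (ball 0 1) •
      ∫ y in (0 : ℝ)..r, y ^ (Module.finrank ℝ E - 1) • f y := by
  have hball : closedBall (0 : E) r = norm ⁻¹' Iic r := by
    ext x
    simp
  have hind : (norm ⁻¹' Iic r).indicator (fun x : E => f ‖x‖) = fun x => (Iic r).indicator f ‖x‖ :=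
    funext fun _ => indicator_comp_right norm
  rw [← integral_indicator measurableSet_closedBall, hball, hind, integral_fun_norm_addHaar μ,
    ← indicator_smul, setIntegral_indicator measurableSet_Iic, Ioi_inter_Iic,
    ← intervalIntegral.integral_of_le hr]

end Radial

section Enneper

theorem isMinimalData_enneperData : IsMinimalData enneperData where
  differentiable := by
    simp only [Fin.forall_fin_succ, enneperData]
    refine ⟨?_, ?_, ?_, nofun⟩ <;> simp
  sum_sq_eq_zero z := by
    simp only [Fin.sum_univ_three, enneperData, Matrix.cons_val]
    linear_combination (1 + z ^ 2) ^ 2 / 4 * Complex.I_sq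
  exists_ne_zero z := by
    by_cases hz : z = 0
    · exact ⟨0, by simp [enneperData, hz]⟩
    · exact ⟨2, hz⟩

theorem conformalFactor_enneperData (z : ℂ) :
    conformalFactor enneperData z = (1 + ‖z‖ ^ 2) ^ 2 / 4 := by
  have hpar := parallelogram_law_with_norm ℝ 1 (z ^ 2)
  simp only [norm_one, norm_pow] at hpar
  simp only [conformalFactor, Fin.sum_univ_three, enneperData, Matrix.cons_val, norm_mul, norm_div,
    norm_one, Complex.norm_I, Complex.norm_ofNat]
  linear_combination hpar / 8

/-- The Gauss map of the Enneper surface: inverse stereographic projection from the north pole. -/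
def enneperNormal (z : ℂ) : EuclideanSpace ℝ (Fin 3) :=
  (1 + ‖z‖ ^ 2)⁻¹ • !₂[2 * z.re, 2 * z.im, ‖z‖ ^ 2 - 1]

theorem sum_mul_enneperNormal (c : Fin 3 → ℂ) (z : ℂ) :
    ∑ i, c i * enneperNormal z i = ((c 0 - Complex.I * c 1) * z +
      (c 0 + Complex.I * c 1) * starRingEnd ℂ z + c 2 * (‖z‖ ^ 2 - 1)) / (1 + ‖z‖ ^ 2) := by
  have hre : (2 * z.re : ℂ) = z + starRingEnd ℂ z := by simpa using (Complex.add_conj z).symm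
  have him : (2 * z.im : ℂ) = Complex.I * (starRingEnd ℂ z - z) :=
    Complex.ext (by simp; ring) (by simp)
  simp only [Fin.sum_univ_three, enneperNormal, PiLp.smul_apply, Matrix.cons_val, smul_eq_mul]
  push_cast
  rw [hre, him]
  ring

theorem isUnitNormal_enneperNormal : IsUnitNormal enneperData enneperNormal where
  contDiff := by
    have hden : ContDiff ℝ ∞ fun z : ℂ => (1 + ‖z‖ ^ 2)⁻¹ :=
      (contDiff_const.add (contDiff_norm_sq ℝ)).inv fun z => by positivity
    refine hden.smul (contDiff_euclidean.2 ?_)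
    simp only [Fin.forall_fin_succ]
    exact ⟨contDiff_const.mul Complex.reCLM.contDiff, contDiff_const.mul Complex.imCLM.contDiff,
      (contDiff_norm_sq ℝ).sub contDiff_const, nofun⟩
  norm_eq_one z := by
    have hsq : ‖z‖ ^ 2 = z.re ^ 2 + z.im ^ 2 := by rw [Complex.sq_norm, Complex.normSq_apply]; ring
    rw [← sq_eq_sq₀ (norm_nonneg _) zero_le_one, enneperNormal, norm_smul, mul_pow,
      EuclideanSpace.norm_sq_eq]
    simp only [Fin.sum_univ_three, Matrix.cons_val, Real.norm_eq_abs, sq_abs]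
    field_simp
    linear_combination -4 * hsq
  sum_mul_eq_zero z := by
    rw [sum_mul_enneperNormal, div_eq_zero_iff]
    left
    simp only [enneperData, Matrix.cons_val]
    linear_combination -z * Complex.mul_conj' z +
      ((1 + z ^ 2) * (starRingEnd ℂ z - z) / 2) * Complex.I_sq

theorem hopfCoeff_enneperData (z : ℂ) : hopfCoeff enneperData enneperNormal z = -1 := by
  have hderiv₀ : deriv (enneperData 0) z = -z := by simp [enneperData]
  have hderiv₁ : deriv (enneperData 1) z = Complex.I * z := by
    simp [enneperData]
    ring
  have hderiv₂ : deriv (enneperData 2) z = 1 := by simp [enneperData]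
  have hne : (1 + ‖z‖ ^ 2 : ℂ) ≠ 0 := by
    norm_cast
    positivity
  rw [hopfCoeff, sum_mul_enneperNormal fun i => deriv (enneperData i) z, hderiv₀, hderiv₁, hderiv₂,
    div_eq_iff hne]
  linear_combination -2 * Complex.mul_conj' z + z * (starRingEnd ℂ z - z) * Complex.I_sq

/-- The test function on the disc of radius `r`: as a point of the sphere, `enneperNormal z` lies
`capHeight r z`, up to the factor `2 / (1 + r ^ 2)`, below the plane of the circle
`enneperNormal '' sphere 0 r`. -/
def capHeight (r : ℝ) (z : ℂ) : ℝ := (r ^ 2 - ‖z‖ ^ 2) / (1 + ‖z‖ ^ 2)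

theorem contDiff_capHeight (r : ℝ) : ContDiff ℝ ∞ (capHeight r) :=
  (contDiff_const.sub (contDiff_norm_sq ℝ)).div (contDiff_const.add (contDiff_norm_sq ℝ))
    fun z => by positivity

theorem capHeight_of_norm_eq {r : ℝ} {z : ℂ} (hz : ‖z‖ = r) : capHeight r z = 0 := by
  rw [capHeight, hz, sub_self, zero_div]

theorem gradient_capHeight (r : ℝ) (z : ℂ) :
    gradient (capHeight r) z = (-(2 * (1 + r ^ 2)) / (1 + ‖z‖ ^ 2) ^ 2) • z := by
  have hnorm : HasFDerivAt (fun z : ℂ => ‖z‖ ^ 2) (2 • innerSL ℝ z) z :=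
    (hasStrictFDerivAt_norm_sq z).hasFDerivAt
  have hquot : HasDerivAt (fun s : ℝ => (r ^ 2 - s) / (1 + s))
      (-(1 + r ^ 2) / (1 + ‖z‖ ^ 2) ^ 2) (‖z‖ ^ 2) := by
    refine (((hasDerivAt_id' _).const_sub (r ^ 2)).div ((hasDerivAt_id' _).const_add 1)
      (by positivity)).congr_deriv ?_
    ring
  refine HasGradientAt.gradient (hasGradientAt_iff_hasFDerivAt.2 ?_)
  refine (hquot.comp_hasFDerivAt z hnorm).congr_fderiv ?_
  ext w
  simp only [smul_apply, innerSL_apply_apply, nsmul_eq_mul, smul_eq_mul,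
    InnerProductSpace.toDual_apply_apply, real_inner_smul_left]
  push_cast
  ring

theorem integral_radial_index_capHeight (r : ℝ) :
    ∫ x in (0 : ℝ)..r, x * ((4 * (1 + r ^ 2) ^ 2 * x ^ 2 - 8 * (r ^ 2 - x ^ 2) ^ 2) /
      (1 + x ^ 2) ^ 4) = -(r ^ 4 * (r ^ 2 - 1) / (r ^ 2 + 1)) := by
  have hne (x : ℝ) : 1 + x ^ 2 ≠ 0 := by positivity
  -- Partial fractions in `1 + x ^ 2` give the antiderivative.
  have hderiv (x : ℝ) : HasDerivAt (fun x : ℝ => 2 * (1 + r ^ 2) ^ 2 / (1 + x ^ 2) ^ 3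
      - (1 + r ^ 2) * (5 + r ^ 2) / (1 + x ^ 2) ^ 2 + 4 / (1 + x ^ 2))
      (x * ((4 * (1 + r ^ 2) ^ 2 * x ^ 2 - 8 * (r ^ 2 - x ^ 2) ^ 2) / (1 + x ^ 2) ^ 4)) x := by
    have hden := (hasDerivAt_pow 2 x).const_add 1
    refine ((((hasDerivAt_const x _).div (hden.pow 3) (pow_ne_zero 3 (hne x))).sub
      ((hasDerivAt_const x _).div (hden.pow 2) (pow_ne_zero 2 (hne x)))).add
      ((hasDerivAt_const x _).div hden (hne x))).congr_deriv ?_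
    simp only [Pi.pow_apply]
    have := hne x
    field_simp
    ring
  have hcont : Continuous fun x : ℝ =>
      x * ((4 * (1 + r ^ 2) ^ 2 * x ^ 2 - 8 * (r ^ 2 - x ^ 2) ^ 2) / (1 + x ^ 2) ^ 4) :=
    continuous_id.mul (Continuous.div (by fun_prop) (by fun_prop) fun x => pow_ne_zero 4 (hne x))
  rw [intervalIntegral.integral_eq_sub_of_hasDerivAt (fun x _ => hderiv x)
    (hcont.intervalIntegrable _ _)]
  field_simp
  ring

theorem indexForm_capHeight {r : ℝ} (hr : 0 ≤ r) :
    indexForm enneperData enneperNormal (closedBall 0 r) (capHeight r) =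
      -(2 * Real.pi * (r ^ 4 * (r ^ 2 - 1) / (r ^ 2 + 1))) := by
  have hdensity (z : ℂ) : ‖gradient (capHeight r) z‖ ^ 2 -
      2 * ‖hopfCoeff enneperData enneperNormal z‖ ^ 2 / conformalFactor enneperData z *
        capHeight r z ^ 2 = (4 * (1 + r ^ 2) ^ 2 * ‖z‖ ^ 2 - 8 * (r ^ 2 - ‖z‖ ^ 2) ^ 2) /
          (1 + ‖z‖ ^ 2) ^ 4 := by
    rw [gradient_capHeight, hopfCoeff_enneperData, conformalFactor_enneperData, capHeight,
      norm_smul, norm_neg, norm_one, mul_pow, Real.norm_eq_abs, sq_abs]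
    field_simp
    ring
  have hdisc : volume.real (ball (0 : ℂ) 1) = Real.pi := by
    simp [Measure.real, Complex.volume_ball]
  simp only [indexForm, hdensity]
  rw [setIntegral_closedBall_fun_norm volume hr fun x =>
    (4 * (1 + r ^ 2) ^ 2 * x ^ 2 - 8 * (r ^ 2 - x ^ 2) ^ 2) / (1 + x ^ 2) ^ 4, hdisc]
  simp only [Complex.finrank_real_complex, Nat.add_one_sub_one, pow_one, smul_eq_mul,
    nsmul_eq_mul, Nat.cast_ofNat, integral_radial_index_capHeight]
  ring

end Enneper

end MinimalSurface

end

theorem corollaryD (r : ℝ) (hr : 1 < r) :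
    MinimalSurface.IsUnstable (Metric.closedBall (0 : ℂ) r) MinimalSurface.enneper := by
  have hr0 : 0 < r := one_pos.trans hr
  have hsq : 0 < r ^ 2 - 1 := sub_pos.2 (one_lt_pow₀ hr two_ne_zero)
  have hsmooth := MinimalSurface.contDiff_capHeight r
  have hboundary : ∀ z ∈ frontier (Metric.closedBall 0 r), MinimalSurface.capHeight r z = 0 := by
    intro z hz
    rw [frontier_closedBall', mem_sphere_zero_iff_norm] at hz
    exact MinimalSurface.capHeight_of_norm_eq hz
  have hneg : MinimalSurface.indexForm MinimalSurface.enneperData MinimalSurface.enneperNormal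
      (Metric.closedBall 0 r) (MinimalSurface.capHeight r) < 0 := by
    rw [MinimalSurface.indexForm_capHeight hr0.le, neg_lt_zero]
    positivity
  exact ⟨_, MinimalSurface.isUnitNormal_enneperNormal.isNormalVariation_smul
    MinimalSurface.isMinimalData_enneperData.differentiable hsmooth hboundary, _,
    MinimalSurface.hasSecondVariation_weierstrassMap_smul MinimalSurface.isMinimalData_enneperData
      MinimalSurface.isUnitNormal_enneperNormal (isCompact_closedBall 0 r)
      (hsmooth.of_le (by simp)), hneg⟩
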